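/- Let $s,t>1$ be coprime integers. A partition $\lambda$ is identified with its Young diagram, whose elements are called nodes; $|\lambda|$ denotes its size. The rim of $\lambda$ is the set of nodes $(r,c)$ of $\lambda$ such that $(r+1,c+1)$ is not a node of $\lambda$. For a positive integer $k$, a rim $k$-hook of $\lambda$ is a connected set of $k$ nodes in the rim whose removal leaves the Young diagram of a partition; a rim hook is a rim $k$-hook for some $k\ge 1$. A partition is an $s$-core if it has no rim $s$-hook, and the $s$-core of $\lambda$ is the partition obtained from $\lambda$ by repeatedly removing rim $s$-hooks until none remain. An $(s,t)$-core is a partition that is both an $s$-core and a $t$-core. Let $\sigma$ and $\tau$ be $(s,t)$-cores and let $n\ge 0$ be an integer. Let $\mathcal P_n(\sigma,\tau)$ be the set of partitions of $n$ with $s$-core $\sigma$ and $t$-core $\tau$, and let $m_{\sigma,\tau}$ be the smallest size of a partition with $s$-core $\sigma$ and $t$-core $\tau$. Then the following are equivalent: 1. $|\mathcal P_n(\sigma,\tau)|=2$; 2. $\tau$ is obtained from $\sigma$ by adding or removing a rim hook, and $n=|\sigma|+s=|\tau|+t$; 3. $n=m_{\sigma,\tau}=|\sigma|+s=|\tau|+t$.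 -/

import Mathlib

/-! Partitions are represented by their Young diagrams (Mathlib's `YoungDiagram`); the size of a
partition is `YoungDiagram.card`. Rows and columns are numbered from `0`. -/

namespace YoungDiagram

/-- The rim of `μ`: the nodes `(r, c)` of `μ` such that `(r + 1, c + 1)` is not a node of `μ`. -/
def rim (μ : YoungDiagram) : Set (ℕ × ℕ) :=
  {x | x ∈ μ ∧ (x.1 + 1, x.2 + 1) ∉ μ}

/-- The grid graph on `ℕ × ℕ`: two nodes are adjacent when they share an edge, i.e. they agree in
one coordinate and differ by exactly one in the other. -/
def gridGraph : SimpleGraph (ℕ × ℕ) where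
  Adj x y :=
    (x.1 = y.1 ∧ (x.2 + 1 = y.2 ∨ y.2 + 1 = x.2)) ∨
    (x.2 = y.2 ∧ (x.1 + 1 = y.1 ∨ y.1 + 1 = x.1))
  symm := ⟨fun x y h => by omega⟩
  loopless := ⟨fun x h => by omega⟩

/-- `RemovesRimHook k lam μ`: the partition `μ` is obtained from the partition `lam` by removing a
rim `k`-hook, that is, a (nonempty) connected set of `k` nodes in the rim of `lam`. -/
def RemovesRimHook (k : ℕ) (lam μ : YoungDiagram) : Prop :=
  ∃ H : Finset (ℕ × ℕ),
    (H : Set (ℕ × ℕ)) ⊆ lam.rim ∧ H.card = k ∧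
    (gridGraph.induce (H : Set (ℕ × ℕ))).Connected ∧
    μ.cells = lam.cells \ H

/-- `lam` is an `s`-core: it has no rim `s`-hooks. -/
def IsCore (s : ℕ) (lam : YoungDiagram) : Prop :=
  ∀ μ : YoungDiagram, ¬ RemovesRimHook s lam μ

/-- `σ` is the `s`-core of `lam`: it is reached from `lam` by successively removing rim `s`-hooks
until none remain. -/
def HasCore (s : ℕ) (lam σ : YoungDiagram) : Prop :=
  Relation.ReflTransGen (RemovesRimHook s) lam σ ∧ IsCore s σ

/-- The set of partitions of `n` with `s`-core `σ` and `t`-core `τ`. -/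
def partitionsWithCores (s t n : ℕ) (σ τ : YoungDiagram) : Set YoungDiagram :=
  {lam | lam.card = n ∧ HasCore s lam σ ∧ HasCore t lam τ}

/-- The smallest size of a partition with `s`-core `σ` and `t`-core `τ`. (For coprime `s` and `t`
such a partition exists for every `s`-core `σ` and every `t`-core `τ`.) -/
noncomputable def minSize (s t : ℕ) (σ τ : YoungDiagram) : ℕ :=
  sInf {n | (partitionsWithCores s t n σ τ).Nonempty}

end YoungDiagram

namespace YoungDiagram

/-! ### Diagonals -/

/-! A partition is encoded by its bead set in `ℤ`, read off from the differences of its diagonal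
lengths. Removing a rim `k`-hook is moving a bead down `k` places into a gap
(`BeadMove.removesRimHook`, `RemovesRimHook.exists_beadMove`). An `s`-core is determined by the
charges of its runners modulo `s`, so any bead move by a multiple of `s` keeps the `s`-core
(`hasCore_iff`, `HasCore.of_beadMove`).

Suppose there are exactly two partitions. Every member has size congruent to `n` modulo `s * t`, and
a member of smaller size would produce three of size `n`; hence `n` is minimal and each member is an
`s * t`-core. A switch replaces two beads by two gaps at the other corners of a parallelogram with
sides divisible by `s` and by `t`. It keeps size and both cores, so each member admits only one
(`IsSwitch.unique`). A bead with a gap `s` below it always gives a switch, because charges are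
monotone along `t`-steps. Uniqueness then makes the `t`-side exactly `t` and leaves only one such
bead, so `n = σ.card + s`; by symmetry `n = τ.card + t`.

Conversely, when both cores are one hook away, `τ` is `σ` with a bead moved from `x` to `x + s - t`,
and the members arise from `σ` by moving `x` to `x + s` or `x - t` to `x + s - t`. -/

/-- The `m`-th node on the diagonal of content `c`. -/
def diagNode (c : ℤ) (m : ℕ) : ℕ × ℕ := (m + (-c).toNat, m + c.toNat)

theorem diagNode_sub_min (p q : ℕ) : diagNode ((q : ℤ) - p) (min p q) = (p, q) := by
  simp only [diagNode, Prod.mk.injEq]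
  omega

theorem content_diagNode (c : ℤ) (m : ℕ) :
    ((diagNode c m).2 : ℤ) - (diagNode c m).1 = c := by
  simp only [diagNode]
  omega

theorem min_diagNode (c : ℤ) (m : ℕ) : min (diagNode c m).1 (diagNode c m).2 = m := by
  simp only [diagNode]
  omega

theorem exists_diagNode_notMem (μ : YoungDiagram) (c : ℤ) : ∃ m, diagNode c m ∉ μ := by
  refine ⟨μ.rowLen 0, fun h => ?_⟩
  rw [diagNode, mem_iff_lt_rowLen] at h
  have := μ.rowLen_anti 0 (μ.rowLen 0 + (-c).toNat) (Nat.zero_le _)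
  omega

/-- The number of nodes of content `c`. -/
noncomputable def diag (μ : YoungDiagram) (c : ℤ) : ℕ := by
  classical exact Nat.find (μ.exists_diagNode_notMem c)

theorem lt_diag_iff (μ : YoungDiagram) (c : ℤ) (m : ℕ) : m < μ.diag c ↔ diagNode c m ∈ μ := by
  classical
  rw [diag, Nat.lt_find_iff]
  constructor
  · intro h
    simpa using h m le_rfl
  · intro h k hk
    rw [not_not]
    exact μ.up_left_mem (by omega) (by omega) h

theorem mem_iff_lt_diag (μ : YoungDiagram) (p q : ℕ) :
    (p, q) ∈ μ ↔ min p q < μ.diag ((q : ℤ) - p) := by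
  rw [lt_diag_iff, diagNode_sub_min]

/-- Left of the main diagonal, the `m`-th node of content `x + 1` lies just above the `m`-th node of
content `x`, and the next one lies just to the right of that node. -/
theorem diag_step_neg (μ : YoungDiagram) {x : ℤ} (hx : x < 0) :
    μ.diag x ≤ μ.diag (x + 1) ∧ μ.diag (x + 1) ≤ μ.diag x + 1 := by
  constructor
  · refine le_of_forall_lt fun m hm => ?_
    rw [lt_diag_iff] at hm ⊢
    refine μ.up_left_mem ?_ ?_ hm <;> omega
  · by_contra! h
    have h1 := (μ.lt_diag_iff (x + 1) (μ.diag x + 1)).1 h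
    have h2 : diagNode x (μ.diag x) ∈ μ := by
      refine μ.up_left_mem ?_ ?_ h1 <;> omega
    rw [← lt_diag_iff] at h2
    omega

theorem diag_step_nonneg (μ : YoungDiagram) {x : ℤ} (hx : 0 ≤ x) :
    μ.diag (x + 1) ≤ μ.diag x ∧ μ.diag x ≤ μ.diag (x + 1) + 1 := by
  constructor
  · refine le_of_forall_lt fun m hm => ?_
    rw [lt_diag_iff] at hm ⊢
    refine μ.up_left_mem ?_ ?_ hm <;> omega
  · by_contra! h
    have h1 := (μ.lt_diag_iff x (μ.diag (x + 1) + 1)).1 h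
    have h2 : diagNode (x + 1) (μ.diag (x + 1)) ∈ μ := by
      refine μ.up_left_mem ?_ ?_ h1 <;> omega
    rw [← lt_diag_iff] at h2
    omega

theorem exists_diag_eq_zero (μ : YoungDiagram) :
    ∃ N : ℕ, ∀ c : ℤ, (N : ℤ) ≤ |c| → μ.diag c = 0 := by
  refine ⟨μ.rowLen 0 + μ.colLen 0, fun c hc => ?_⟩
  by_contra h
  have h1 := (μ.lt_diag_iff c 0).1 (Nat.pos_of_ne_zero h)
  have h2 := h1
  rw [diagNode, mem_iff_lt_rowLen] at h1
  rw [diagNode, mem_iff_lt_colLen] at h2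
  have h3 := μ.rowLen_anti 0 (0 + (-c).toNat) (Nat.zero_le _)
  have h4 := μ.colLen_anti 0 (0 + c.toNat) (Nat.zero_le _)
  push_cast at hc
  rcases abs_cases c with h | h <;> omega

theorem diag_injective {μ ν : YoungDiagram} (h : ∀ c, μ.diag c = ν.diag c) : μ = ν := by
  ext ⟨p, q⟩
  rw [mem_cells, mem_cells, mem_iff_lt_diag, mem_iff_lt_diag, h]

/-- A finitely supported function with the step behaviour of diagonal lengths is the diagonal
length function of a Young diagram. -/
theorem exists_diag_eq (D : ℤ → ℕ) (N : ℕ) (hN : ∀ c : ℤ, (N : ℤ) ≤ |c| → D c = 0)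
    (hneg : ∀ x < 0, D x ≤ D (x + 1) ∧ D (x + 1) ≤ D x + 1)
    (hpos : ∀ x, 0 ≤ x → D (x + 1) ≤ D x ∧ D x ≤ D (x + 1) + 1) :
    ∃ μ : YoungDiagram, ∀ c, μ.diag c = D c := by
  classical
  let S : Finset (ℕ × ℕ) :=
    (Finset.Icc (-(N : ℤ)) N).biUnion fun c => (Finset.range (D c)).image (diagNode c)
  have hS : ∀ p q : ℕ, (p, q) ∈ S ↔ min p q < D ((q : ℤ) - p) := by
    intro p q
    simp only [S, Finset.mem_biUnion, Finset.mem_image, Finset.mem_range, Finset.mem_Icc]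
    constructor
    · rintro ⟨c, -, m, hm, h⟩
      have h1 := content_diagNode c m
      have h2 := min_diagNode c m
      rw [h] at h1 h2
      simp only at h1 h2
      rwa [h1, h2]
    · intro h
      refine ⟨(q : ℤ) - p, ?_, min p q, h, diagNode_sub_min p q⟩
      by_contra hc
      have := hN ((q : ℤ) - p) (by rcases abs_cases ((q : ℤ) - p) with h | h <;> omega)
      omega
  have hrow : ∀ p q : ℕ, (p + 1, q) ∈ S → (p, q) ∈ S := by
    intro p q h
    rw [hS] at h ⊢
    have e : ((q : ℤ) - p) = ((q : ℤ) - (p + 1 : ℕ)) + 1 := by push_cast; ring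
    rw [e]
    rcases lt_or_ge ((q : ℤ) - (p + 1 : ℕ)) 0 with hx | hx
    · have := hneg _ hx
      omega
    · have := hpos _ hx
      omega
  have hcol : ∀ p q : ℕ, (p, q + 1) ∈ S → (p, q) ∈ S := by
    intro p q h
    rw [hS] at h ⊢
    have e : (((q + 1 : ℕ) : ℤ) - p) = ((q : ℤ) - p) + 1 := by push_cast; ring
    rw [e] at h
    rcases lt_or_ge ((q : ℤ) - p) 0 with hx | hx
    · have := hneg _ hx
      omega
    · have := hpos _ hx
      omega
  have hrow' : ∀ d p q : ℕ, (p + d, q) ∈ S → (p, q) ∈ S := by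
    intro d
    induction d with
    | zero => exact fun p q h => h
    | succ d ih => exact fun p q h => ih p q (hrow _ _ h)
  have hcol' : ∀ d p q : ℕ, (p, q + d) ∈ S → (p, q) ∈ S := by
    intro d
    induction d with
    | zero => exact fun p q h => h
    | succ d ih => exact fun p q h => ih p q (hcol _ _ h)
  let μ : YoungDiagram :=
    { cells := S
      isLowerSet := by
        rintro ⟨p, q⟩ ⟨p', q'⟩ ⟨hp, hq⟩ h
        simp only at hp hq
        apply hrow' (p - p')
        apply hcol' (q - q')
        rw [Nat.add_sub_cancel' hp, Nat.add_sub_cancel' hq]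
        exact h }
  refine ⟨μ, fun c => ?_⟩
  refine eq_of_forall_lt_iff fun m => ?_
  rw [lt_diag_iff]
  change diagNode c m ∈ S ↔ _
  have := hS (diagNode c m).1 (diagNode c m).2
  rwa [content_diagNode, min_diagNode] at this

/-! ### Bead sets -/

/-- The bead positions of `μ` on the doubly infinite abacus; for the empty partition they are the
negative integers. -/
def beads (μ : YoungDiagram) : Set ℤ :=
  {x | (μ.diag x : ℤ) - μ.diag (x + 1) + (if x < 0 then 1 else 0) = 1}

theorem diag_of_mem_beads {μ : YoungDiagram} {x : ℤ} (h : x ∈ μ.beads) :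
    (μ.diag x : ℤ) - μ.diag (x + 1) + (if x < 0 then 1 else 0) = 1 := h

/-- The step inequalities leave only the values `0` and `1`, so the bead set records every
difference of `diag`. -/
theorem diag_of_notMem_beads {μ : YoungDiagram} {x : ℤ} (h : x ∉ μ.beads) :
    (μ.diag x : ℤ) - μ.diag (x + 1) + (if x < 0 then 1 else 0) = 0 := by
  simp only [beads, Set.mem_ofPred_eq] at h
  rcases lt_or_ge x 0 with hx | hx
  · have := μ.diag_step_neg hx
    split_ifs at h ⊢ <;> omega
  · have := μ.diag_step_nonneg hx
    split_ifs at h ⊢ <;> omega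

theorem exists_beads_bound (μ : YoungDiagram) :
    ∃ N : ℤ, (∀ x < -N, x ∈ μ.beads) ∧ ∀ x, N < x → x ∉ μ.beads := by
  obtain ⟨N, hN⟩ := μ.exists_diag_eq_zero
  refine ⟨N + 1, fun x hx => ?_, fun x hx => ?_⟩
  · have h1 := hN x (by rcases abs_cases x with h | h <;> omega)
    have h2 := hN (x + 1) (by rcases abs_cases (x + 1) with h | h <;> omega)
    simp only [beads, Set.mem_ofPred_eq, h1, h2]
    split_ifs <;> omega
  · have h1 := hN x (by rcases abs_cases x with h | h <;> omega)
    have h2 := hN (x + 1) (by rcases abs_cases (x + 1) with h | h <;> omega)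
    simp only [beads, Set.mem_ofPred_eq, h1, h2]
    split_ifs <;> omega

theorem beads_injective {μ ν : YoungDiagram} (h : μ.beads = ν.beads) : μ = ν := by
  obtain ⟨M, hM⟩ := μ.exists_diag_eq_zero
  obtain ⟨N, hN⟩ := ν.exists_diag_eq_zero
  -- Descending recursion from a content where both diagonals are empty; the beads give each
  -- difference.
  have key : ∀ k : ℕ, μ.diag ((M + N : ℕ) - k : ℤ) = ν.diag ((M + N : ℕ) - k : ℤ) := by
    intro k
    induction k with
    | zero =>
      rw [hM _ (by push_cast; rcases abs_cases ((M : ℤ) + N - 0) with h | h <;> omega),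
        hN _ (by push_cast; rcases abs_cases ((M : ℤ) + N - 0) with h | h <;> omega)]
    | succ k ih =>
      set x : ℤ := (M + N : ℕ) - (k + 1 : ℕ) with hx
      have e : ((M + N : ℕ) - k : ℤ) = x + 1 := by rw [hx]; push_cast; ring
      rw [e] at ih
      by_cases hb : x ∈ μ.beads
      · have h1 := diag_of_mem_beads hb
        rw [h] at hb
        have h2 := diag_of_mem_beads hb
        omega
      · have h1 := diag_of_notMem_beads hb
        rw [h] at hb
        have h2 := diag_of_notMem_beads hb
        omega
  refine diag_injective fun c => ?_
  rcases lt_or_ge (M + N : ℤ) c with hc | hc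
  · rw [hM _ (by rcases abs_cases c with h | h <;> omega),
      hN _ (by rcases abs_cases c with h | h <;> omega)]
  · have := key (M + N - c).toNat
    have e : ((M + N : ℕ) - ((M + N - c).toNat : ℕ) : ℤ) = c := by push_cast; omega
    rwa [e] at this

/-- `ν` is obtained from `μ` by moving a bead from position `x` to the empty position `y`. -/
def BeadMove (μ ν : YoungDiagram) (x y : ℤ) : Prop :=
  x ∈ μ.beads ∧ y ∉ μ.beads ∧ ∀ z, z ∈ ν.beads ↔ z = y ∨ z ∈ μ.beads ∧ z ≠ x

namespace BeadMove

variable {μ ν ρ : YoungDiagram} {x y : ℤ}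

theorem ne (h : BeadMove μ ν x y) : x ≠ y := fun e => h.2.1 (e ▸ h.1)

theorem symm (h : BeadMove μ ν x y) : BeadMove ν μ y x := by
  have hne := h.ne
  obtain ⟨hx, hy, hz⟩ := h
  refine ⟨(hz y).2 (Or.inl rfl), fun h => ?_, fun z => ?_⟩
  · rcases (hz x).1 h with h | h
    · exact hne h
    · exact h.2 rfl
  · rw [hz]
    by_cases h1 : z = x
    · subst h1; tauto
    · by_cases h2 : z = y
      · subst h2; tauto
      · tauto

theorem unique (h : BeadMove μ ν x y) (h' : BeadMove μ ρ x y) : ν = ρ :=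
  beads_injective (Set.ext fun z => (h.2.2 z).trans (h'.2.2 z).symm)

end BeadMove

/-- Shifting the diagonal lengths by one on an interval moves one bead. -/
theorem beadMove_of_diag {μ ν : YoungDiagram} {x y : ℤ} (hyx : y < x)
    (h : ∀ c, (μ.diag c : ℤ) = ν.diag c + if y < c ∧ c ≤ x then 1 else 0) :
    BeadMove μ ν x y := by
  have key : ∀ z, ((μ.diag z : ℤ) - μ.diag (z + 1)) =
      (ν.diag z - ν.diag (z + 1)) + (if z = x then 1 else 0) - (if z = y then 1 else 0) := by
    intro z
    rw [h z, h (z + 1)]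
    split_ifs <;> omega
  have mem_or : ∀ (ρ : YoungDiagram) z,
      (z ∈ ρ.beads ∧ (ρ.diag z : ℤ) - ρ.diag (z + 1) + (if z < 0 then 1 else 0) = 1) ∨
      (z ∉ ρ.beads ∧ (ρ.diag z : ℤ) - ρ.diag (z + 1) + (if z < 0 then 1 else 0) = 0) := by
    intro ρ z
    by_cases hz : z ∈ ρ.beads
    · exact Or.inl ⟨hz, diag_of_mem_beads hz⟩
    · exact Or.inr ⟨hz, diag_of_notMem_beads hz⟩
  refine ⟨?_, ?_, fun z => ?_⟩
  · have hk := key x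
    rw [if_pos rfl, if_neg (by omega)] at hk
    rcases mem_or μ x with h1 | h1
    · exact h1.1
    · rcases mem_or ν x with h2 | h2 <;> omega
  · have hk := key y
    rw [if_pos rfl, if_neg (by omega)] at hk
    rcases mem_or μ y with h1 | h1
    · rcases mem_or ν y with h2 | h2 <;> omega
    · exact h1.1
  · have hk := key z
    rcases mem_or μ z with h1 | h1 <;> rcases mem_or ν z with h2 | h2 <;>
      simp only [h1.1, h2.1, true_and, false_and, true_iff, false_iff, or_false] <;>
      (split_ifs at hk <;> omega)

/-! ### Rim hooks and bead moves -/

/-- The rim has one node on each nonempty diagonal, the last; a rim hook is thus determined by its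
contents. -/
theorem mem_rim_iff (μ : YoungDiagram) (p q : ℕ) :
    (p, q) ∈ μ.rim ↔ min p q + 1 = μ.diag ((q : ℤ) - p) := by
  simp only [rim, Set.mem_ofPred_eq, mem_iff_lt_diag]
  have e : (((q + 1 : ℕ) : ℤ) - (p + 1 : ℕ)) = (q : ℤ) - p := by push_cast; ring
  rw [e]
  omega

/-- The last node on the diagonal of content `c` (a junk value if there is none). -/
noncomputable def lastNode (μ : YoungDiagram) (c : ℤ) : ℕ × ℕ := diagNode c (μ.diag c - 1)

theorem eq_lastNode_of_mem_rim {μ : YoungDiagram} {u : ℕ × ℕ} (h : u ∈ μ.rim) :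
    u = μ.lastNode ((u.2 : ℤ) - u.1) := by
  obtain ⟨p, q⟩ := u
  rw [mem_rim_iff] at h
  rw [lastNode, ← h, Nat.add_sub_cancel, diagNode_sub_min]

theorem lastNode_mem_rim {μ : YoungDiagram} {c : ℤ} (h : 0 < μ.diag c) :
    μ.lastNode c ∈ μ.rim := by
  have := (μ.mem_rim_iff (μ.lastNode c).1 (μ.lastNode c).2).2
  apply this
  rw [lastNode, content_diagNode, min_diagNode]
  omega

theorem adj_lastNode {μ : YoungDiagram} {c : ℤ} (h : 0 < μ.diag c) (h' : 0 < μ.diag (c + 1)) :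
    gridGraph.Adj (μ.lastNode c) (μ.lastNode (c + 1)) := by
  simp only [gridGraph, lastNode, diagNode]
  rcases lt_or_ge c 0 with hc | hc
  · have := μ.diag_step_neg hc
    omega
  · have := μ.diag_step_nonneg hc
    omega

/-- An empty diagonal at `c < 0` empties all those to its left, making `y` a bead; one at `c ≥ 0`
empties all those to its right, making `x` a gap. -/
theorem diag_pos_of_between {μ : YoungDiagram} {x y c : ℤ} (hx : x ∈ μ.beads) (hy : y ∉ μ.beads)
    (hyc : y < c) (hcx : c ≤ x) : 0 < μ.diag c := by
  by_contra! h0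
  have h0 : μ.diag c = 0 := by omega
  rcases lt_or_ge c 0 with hc | hc
  · have : ∀ k : ℕ, μ.diag (c - k) = 0 := by
      intro k
      induction k with
      | zero => simpa using h0
      | succ k ih =>
        have := μ.diag_step_neg (x := c - (k + 1 : ℕ)) (by push_cast; omega)
        have e : c - (k + 1 : ℕ) + 1 = c - k := by push_cast; ring
        rw [e] at this
        omega
    have h1 := this (c - y).toNat
    have h2 := this (c - y - 1).toNat
    rw [show c - ((c - y).toNat : ℤ) = y by omega] at h1
    rw [show c - ((c - y - 1).toNat : ℤ) = y + 1 by omega] at h2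
    have := diag_of_notMem_beads hy
    rw [h1, h2, if_pos (by omega)] at this
    simp at this
  · have : ∀ k : ℕ, μ.diag (c + k) = 0 := by
      intro k
      induction k with
      | zero => simpa using h0
      | succ k ih =>
        have := μ.diag_step_nonneg (x := c + k) (by omega)
        have e : c + (k + 1 : ℕ) = c + k + 1 := by push_cast; ring
        rw [e]
        omega
    have h1 := this (x - c).toNat
    have h2 := this (x - c + 1).toNat
    rw [show c + ((x - c).toNat : ℤ) = x by omega] at h1
    rw [show c + ((x - c + 1).toNat : ℤ) = x + 1 by omega] at h2
    have := diag_of_mem_beads hx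
    rw [h1, h2, if_neg (by omega)] at this
    simp at this

/-- The bead at `x` and the gap at `y` are what keeps the step inequalities true at the two ends of
the interval; `diag_pos_of_between` makes the truncated subtraction exact. -/
theorem exists_beadMove_down {μ : YoungDiagram} {x y : ℤ} (hx : x ∈ μ.beads) (hy : y ∉ μ.beads)
    (hyx : y < x) :
    ∃ ν : YoungDiagram, ∀ c, (μ.diag c : ℤ) = ν.diag c + if y < c ∧ c ≤ x then 1 else 0 := by
  obtain ⟨N, hN⟩ := μ.exists_diag_eq_zero
  have hp := fun c => diag_pos_of_between (c := c) hx hy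
  have hx' := diag_of_mem_beads hx
  have hy' := diag_of_notMem_beads hy
  obtain ⟨ν, hν⟩ := exists_diag_eq (fun c => μ.diag c - if y < c ∧ c ≤ x then 1 else 0) N
    (fun c hc => by simp [hN c hc])
    (fun z hz => by
      have := μ.diag_step_neg hz
      have h1 := hp z
      have h2 := hp (z + 1)
      rcases eq_or_ne z x with rfl | hzx
      · simp only [hz, if_true] at hx'
        split_ifs <;> omega
      · rcases eq_or_ne z y with rfl | hzy
        · simp only [hz, if_true] at hy'
          split_ifs <;> omega
        · split_ifs <;> omega)
    (fun z hz => by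
      have := μ.diag_step_nonneg hz
      have h1 := hp z
      have h2 := hp (z + 1)
      rcases eq_or_ne z x with rfl | hzx
      · simp only [not_lt.2 hz, if_false] at hx'
        split_ifs <;> omega
      · rcases eq_or_ne z y with rfl | hzy
        · simp only [not_lt.2 hz, if_false] at hy'
          split_ifs <;> omega
        · split_ifs <;> omega)
  refine ⟨ν, fun c => ?_⟩
  rw [hν]
  have := hp c
  split_ifs with h
  · have := this h.1 h.2
    omega
  · simp

theorem exists_beadMove_up {μ : YoungDiagram} {x y : ℤ} (hx : x ∈ μ.beads) (hy : y ∉ μ.beads)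
    (hxy : x < y) :
    ∃ ν : YoungDiagram, ∀ c, (ν.diag c : ℤ) = μ.diag c + if x < c ∧ c ≤ y then 1 else 0 := by
  obtain ⟨N, hN⟩ := μ.exists_diag_eq_zero
  have hx' := diag_of_mem_beads hx
  have hy' := diag_of_notMem_beads hy
  obtain ⟨ν, hν⟩ := exists_diag_eq (fun c => μ.diag c + if x < c ∧ c ≤ y then 1 else 0)
    (N + x.natAbs + y.natAbs + 1)
    (fun c hc => by
      have := hN c (by
        push_cast at hc
        rcases abs_cases x with h | h <;> rcases abs_cases y with h | h <;> omega)
      push_cast at hc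
      rcases abs_cases c with h | h <;> rcases abs_cases x with h | h <;>
        rcases abs_cases y with h | h <;> split_ifs <;> omega)
    (fun z hz => by
      have := μ.diag_step_neg hz
      rcases eq_or_ne z x with rfl | hzx
      · simp only [hz, if_true] at hx'
        split_ifs <;> omega
      · rcases eq_or_ne z y with rfl | hzy
        · simp only [hz, if_true] at hy'
          split_ifs <;> omega
        · split_ifs <;> omega)
    (fun z hz => by
      have := μ.diag_step_nonneg hz
      rcases eq_or_ne z x with rfl | hzx
      · simp only [not_lt.2 hz, if_false] at hx'
        split_ifs <;> omega
      · rcases eq_or_ne z y with rfl | hzy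
        · simp only [not_lt.2 hz, if_false] at hy'
          split_ifs <;> omega
        · split_ifs <;> omega)
  refine ⟨ν, fun c => ?_⟩
  rw [hν]
  push_cast
  rfl

theorem exists_beadMove {μ : YoungDiagram} {x y : ℤ} (hx : x ∈ μ.beads) (hy : y ∉ μ.beads) :
    ∃ ν, BeadMove μ ν x y := by
  rcases lt_trichotomy x y with h | h | h
  · obtain ⟨ν, hν⟩ := exists_beadMove_up hx hy h
    exact ⟨ν, (beadMove_of_diag h hν).symm⟩
  · exact absurd (h ▸ hx) hy
  · obtain ⟨ν, hν⟩ := exists_beadMove_down hx hy h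
    exact ⟨ν, beadMove_of_diag h hν⟩

theorem lastNode_injective (μ : YoungDiagram) : Function.Injective μ.lastNode := by
  intro c d h
  rw [← content_diagNode c (μ.diag c - 1), ← content_diagNode d (μ.diag d - 1)]
  change (((μ.lastNode c).2 : ℤ) - (μ.lastNode c).1) = (μ.lastNode d).2 - (μ.lastNode d).1
  rw [h]

theorem BeadMove.removesRimHook {μ ν : YoungDiagram} {x : ℤ} {k : ℕ} (hk : 0 < k)
    (h : BeadMove μ ν x (x - k)) : RemovesRimHook k μ ν := by
  classical
  have hlt : x - k < x := by omega
  obtain ⟨ν', hν'⟩ := exists_beadMove_down h.1 h.2.1 hlt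
  obtain rfl : ν = ν' := h.unique (beadMove_of_diag hlt hν')
  have hpos : ∀ c, x - k < c → c ≤ x → 0 < μ.diag c :=
    fun c => diag_pos_of_between h.1 h.2.1
  let H : Finset (ℕ × ℕ) := (Finset.Ioc (x - k) x).image μ.lastNode
  have memH : ∀ u, u ∈ H ↔ ∃ c, (x - k < c ∧ c ≤ x) ∧ μ.lastNode c = u := by
    intro u
    simp [H, Finset.mem_image, Finset.mem_Ioc]
  refine ⟨H, ?_, ?_, ?_, ?_⟩
  · intro u hu
    obtain ⟨c, hc, rfl⟩ := (memH u).1 hu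
    exact lastNode_mem_rim (hpos c hc.1 hc.2)
  · rw [Finset.card_image_of_injective _ μ.lastNode_injective, Int.card_Ioc]
    omega
  · have mem : ∀ c, x - k < c → c ≤ x → μ.lastNode c ∈ (H : Set (ℕ × ℕ)) :=
      fun c h1 h2 => (memH _).2 ⟨c, ⟨h1, h2⟩, rfl⟩
    have reach : ∀ d : ℕ, ∀ hd : x - d > x - k,
        (gridGraph.induce (H : Set (ℕ × ℕ))).Reachable ⟨μ.lastNode x, mem x hlt le_rfl⟩
          ⟨μ.lastNode (x - d), mem _ hd (by omega)⟩ := by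
      intro d
      induction d with
      | zero =>
        intro hd
        simp
      | succ d ih =>
        intro hd
        refine (ih (by push_cast at hd; omega)).trans (SimpleGraph.Adj.reachable ?_)
        rw [SimpleGraph.comap_adj]
        have := adj_lastNode (μ := μ) (c := x - (d + 1 : ℕ)) (hpos _ hd (by push_cast; omega))
          (hpos _ (by omega) (by push_cast; omega))
        rw [show x - (d + 1 : ℕ) + 1 = x - d by push_cast; ring] at this
        exact this.symm
    rw [SimpleGraph.connected_iff_exists_forall_reachable]
    refine ⟨⟨μ.lastNode x, mem x hlt le_rfl⟩, fun ⟨u, hu⟩ => ?_⟩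
    obtain ⟨c, hc, rfl⟩ := (memH u).1 hu
    have := reach (x - c).toNat (by omega)
    have e : x - ((x - c).toNat : ℤ) = c := by omega
    simp only [e] at this
    exact this
  · ext ⟨p, q⟩
    rw [Finset.mem_sdiff, mem_cells, mem_cells, mem_iff_lt_diag, mem_iff_lt_diag, memH]
    have e := hν' ((q : ℤ) - p)
    constructor
    · intro h1
      refine ⟨by split_ifs at e <;> omega, ?_⟩
      rintro ⟨c, hc, hcu⟩
      have h2 := content_diagNode c (μ.diag c - 1)
      have h3 := min_diagNode c (μ.diag c - 1)
      rw [lastNode] at hcu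
      rw [hcu] at h2 h3
      simp only at h2 h3
      rw [h2, if_pos hc] at e
      rw [h2] at h1
      omega
    · rintro ⟨h1, h2⟩
      by_contra h3
      apply h2
      have hc : x - k < (q : ℤ) - p ∧ (q : ℤ) - p ≤ x := by
        by_contra hc
        rw [if_neg hc] at e
        omega
      refine ⟨_, hc, ?_⟩
      rw [if_pos hc] at e
      rw [lastNode, show μ.diag ((q : ℤ) - p) - 1 = min p q by omega, diagNode_sub_min]

theorem RemovesRimHook.exists_beadMove {k : ℕ} {μ ν : YoungDiagram} (h : RemovesRimHook k μ ν) :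
    0 < k ∧ ∃ x, BeadMove μ ν x (x - k) := by
  classical
  obtain ⟨H, hrim, hcard, hconn, hcells⟩ := h
  let ct : ℕ × ℕ → ℤ := fun u => (u.2 : ℤ) - u.1
  let K : Finset ℤ := H.image ct
  have hlast : ∀ u ∈ H, u = μ.lastNode (ct u) := fun u hu => eq_lastNode_of_mem_rim (hrim hu)
  have hKcard : K.card = k := by
    rw [← hcard]
    refine Finset.card_image_of_injOn fun u hu v hv huv => ?_
    rw [hlast u hu, hlast v hv, huv]
  have memK : ∀ c, c ∈ K ↔ μ.lastNode c ∈ H := by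
    intro c
    constructor
    · intro hc
      obtain ⟨u, hu, rfl⟩ := Finset.mem_image.1 hc
      rw [← hlast u hu]
      exact hu
    · intro hc
      exact Finset.mem_image.2 ⟨_, hc, content_diagNode _ _⟩
  have hKne : K.Nonempty := by
    obtain ⟨⟨u, hu⟩⟩ := hconn.nonempty
    exact ⟨ct u, Finset.mem_image_of_mem _ hu⟩
  have hk : 0 < k := hKcard ▸ hKne.card_pos
  -- Adjacent nodes differ by one in content, so a path inside `H` cannot jump over `c`.
  have hconv : ∀ a ∈ K, ∀ b ∈ K, ∀ c, a < c → c < b → c ∈ K := by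
    intro a ha b hb c hac hcb
    by_contra hcK
    obtain ⟨u, hu, rfl⟩ := Finset.mem_image.1 ha
    obtain ⟨v, hv, rfl⟩ := Finset.mem_image.1 hb
    have hr := hconn.preconnected ⟨u, hu⟩ ⟨v, hv⟩
    rw [SimpleGraph.reachable_iff_reflTransGen] at hr
    have : ct v < c := by
      refine Relation.ReflTransGen.head_induction_on
        (motive := fun w _ => ct w.1 < c → ct v < c) hr (fun h => h) ?_ hac
      rintro ⟨w, hw⟩ ⟨w', hw'⟩ hadj - ih hlt
      apply ih
      rw [SimpleGraph.comap_adj] at hadj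
      have hne : ct w' ≠ c := fun e => hcK (e ▸ Finset.mem_image_of_mem _ hw')
      simp only [gridGraph, ct, Function.Embedding.subtype_apply] at hadj hlt hne ⊢
      omega
    omega
  have hK : K = Finset.Icc (K.min' hKne) (K.max' hKne) := by
    ext c
    rw [Finset.mem_Icc]
    refine ⟨fun hc => ⟨K.min'_le c hc, K.le_max' c hc⟩, fun ⟨h1, h2⟩ => ?_⟩
    rcases h1.eq_or_lt with h1 | h1
    · exact h1 ▸ K.min'_mem hKne
    · rcases h2.eq_or_lt with h2 | h2
      · exact h2 ▸ K.max'_mem hKne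
      · exact hconv _ (K.min'_mem hKne) _ (K.max'_mem hKne) c h1 h2
  set a := K.min' hKne
  set b := K.max' hKne
  have hab : a = b - k + 1 := by
    have := hKcard
    rw [hK, Int.card_Icc] at this
    omega
  refine ⟨hk, b, beadMove_of_diag (by omega) fun c => ?_⟩
  have hiff : ∀ m, m < ν.diag c ↔ m < μ.diag c ∧ ¬ (c ∈ K ∧ m = μ.diag c - 1) := by
    intro m
    rw [lt_diag_iff, lt_diag_iff, ← mem_cells, hcells, Finset.mem_sdiff, mem_cells]
    refine and_congr_right fun _ => not_congr ?_
    constructor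
    · intro hm
      have h1 := hlast _ hm
      have h2 : ct (diagNode c m) = c := content_diagNode c m
      rw [h2] at h1
      refine ⟨(memK c).2 (h1 ▸ hm), ?_⟩
      have h3 := min_diagNode c m
      rw [h1, lastNode, min_diagNode] at h3
      exact h3.symm
    · rintro ⟨h1, rfl⟩
      exact (memK c).1 h1
  have hcK : c ∈ K ↔ b - k < c ∧ c ≤ b := by
    rw [hK, Finset.mem_Icc]
    omega
  have hpos : c ∈ K → 0 < μ.diag c := by
    intro hc
    have h1 := (μ.mem_rim_iff (μ.lastNode c).1 (μ.lastNode c).2).1 (hrim ((memK c).1 hc))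
    rw [lastNode, content_diagNode] at h1
    omega
  by_cases hc : c ∈ K
  · have := hpos hc
    rw [if_pos (hcK.1 hc)]
    have h1 : ¬ μ.diag c - 1 < ν.diag c := fun h => ((hiff _).1 h).2 ⟨hc, rfl⟩
    have h2 : 2 ≤ μ.diag c → μ.diag c - 2 < ν.diag c :=
      fun h => (hiff _).2 ⟨by omega, fun h' => by omega⟩
    omega
  · rw [if_neg (fun h => hc (hcK.2 h))]
    have := eq_of_forall_lt_iff fun m => (hiff m).trans (and_iff_left fun h => hc h.1)
    omega

theorem RemovesRimHook.card_eq {k : ℕ} {μ ν : YoungDiagram} (h : RemovesRimHook k μ ν) :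
    μ.card = ν.card + k := by
  obtain ⟨H, hrim, hcard, -, hcells⟩ := h
  have hsub : H ⊆ μ.cells := fun u hu => (hrim hu).1
  have := Finset.card_sdiff_add_card_eq_card hsub
  rw [← hcells, hcard] at this
  exact this.symm

theorem BeadMove.card_eq {μ ν : YoungDiagram} {x y : ℤ} (h : BeadMove μ ν x y) :
    (ν.card : ℤ) = μ.card + (y - x) := by
  rcases lt_trichotomy x y with hxy | hxy | hxy
  · have h' := h.symm
    rw [show x = y - ((y - x).toNat : ℤ) by omega] at h'
    have := (h'.removesRimHook (by omega)).card_eq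
    omega
  · exact absurd hxy h.ne
  · have h' := h
    rw [show y = x - ((x - y).toNat : ℤ) by omega] at h'
    have := (h'.removesRimHook (by omega)).card_eq
    omega

/-! ### Charges -/

/-- `A` contains all sufficiently negative integers and no sufficiently large ones. -/
def IsMaya (A : Set ℤ) : Prop :=
  ∃ N : ℤ, (∀ x < -N, x ∈ A) ∧ ∀ x, N < x → x ∉ A

open Classical in
/-- The number of nonnegative members minus the number of negative non-members. -/
noncomputable def charge (A : Set ℤ) : ℤ :=
  ∑ᶠ j : ℤ, ((if j ∈ A then 1 else 0) - (if j < 0 then 1 else 0) : ℤ)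

-- Far out the two indicators cancel, so the `finsum` is not at its default value. Any large window
-- works, hence two charges can be compared over a common one.
open Classical in
theorem IsMaya.charge_eq {A : Set ℤ} (hA : IsMaya A) :
    ∃ N : ℤ, ∀ M : ℤ, N ≤ M → charge A =
      ∑ j ∈ Finset.Icc (-M) M, ((if j ∈ A then 1 else 0) - (if j < 0 then 1 else 0) : ℤ) := by
  obtain ⟨N, h1, h2⟩ := hA
  refine ⟨|N|, fun M hM => ?_⟩
  refine finsum_eq_sum_of_support_subset _ fun j hj => ?_
  rw [Finset.coe_Icc, Set.mem_Icc]
  by_contra hj'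
  apply hj
  have hN := le_abs_self N
  have hN' := abs_nonneg N
  rcases lt_or_ge j (-M) with h | h
  · simp only [if_pos (h1 j (by omega)), if_pos (show j < 0 by omega), sub_self]
  · simp only [if_neg (h2 j (by omega)), if_neg (show ¬ j < 0 by omega), sub_self]

theorem charge_lt_of_ssubset {A B : Set ℤ} (hA : IsMaya A) (hB : IsMaya B) (h : A ⊂ B) :
    charge A < charge B := by
  classical
  obtain ⟨N, hN⟩ := hA.charge_eq
  obtain ⟨N', hN'⟩ := hB.charge_eq
  obtain ⟨j, hjB, hjA⟩ := Set.exists_of_ssubset h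
  set M := max (max N N') |j|
  rw [hN M (by simp [M]), hN' M (by simp [M])]
  have hj : |j| ≤ M := le_max_right _ _
  refine Finset.sum_lt_sum (fun i _ => ?_) ⟨j, Finset.mem_Icc.2 (abs_le.1 hj), ?_⟩
  · by_cases hi : i ∈ A
    · simp [hi, h.1 hi]
    · by_cases hi' : i ∈ B <;> simp [hi, hi']
  · simp [hjA, hjB]

theorem charge_mono {A B : Set ℤ} (hA : IsMaya A) (hB : IsMaya B) (h : A ⊆ B) :
    charge A ≤ charge B := by
  rcases h.eq_or_ssubset with rfl | h
  · exact le_rfl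
  · exact (charge_lt_of_ssubset hA hB h).le

theorem eq_of_subset_of_charge_eq {A B : Set ℤ} (hA : IsMaya A) (hB : IsMaya B) (h : A ⊆ B)
    (hc : charge A = charge B) : A = B := by
  rcases h.eq_or_ssubset with rfl | h
  · rfl
  · exact absurd hc (charge_lt_of_ssubset hA hB h).ne

theorem charge_move {A B : Set ℤ} (hA : IsMaya A) (hB : IsMaya B) {p q : ℤ} (hp : p ∈ A)
    (hq : q ∉ A) (h : ∀ z, z ∈ B ↔ z = q ∨ z ∈ A ∧ z ≠ p) : charge B = charge A := by
  classical
  obtain ⟨N, hN⟩ := hA.charge_eq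
  obtain ⟨N', hN'⟩ := hB.charge_eq
  set M := max (max N N') (max |p| |q|)
  rw [hN M (by simp [M]), hN' M (by simp [M]), ← sub_eq_zero, ← Finset.sum_sub_distrib]
  have hp' : p ∈ Finset.Icc (-M) M := Finset.mem_Icc.2 (abs_le.1 (by simp [M]))
  have hq' : q ∈ Finset.Icc (-M) M := Finset.mem_Icc.2 (abs_le.1 (by simp [M]))
  have hpq : p ≠ q := fun e => hq (e ▸ hp)
  calc _ = ∑ j ∈ Finset.Icc (-M) M, ((if j = q then 1 else 0) - (if j = p then 1 else 0) : ℤ) := by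
        refine Finset.sum_congr rfl fun j _ => ?_
        rcases eq_or_ne j q with rfl | h1
        · simp [(h j).2 (Or.inl rfl), hq, hpq.symm]
        · rcases eq_or_ne j p with rfl | h2
          · have : j ∉ B := fun hj => by
              rcases (h j).1 hj with h | h
              · exact hpq h
              · exact h.2 rfl
            simp only [this, hp, hpq, if_true, if_false]
            ring
          · have : j ∈ B ↔ j ∈ A := by rw [h]; tauto
            simp [this, h1, h2]
    _ = 0 := by
        rw [Finset.sum_sub_distrib, Finset.sum_ite_eq' , Finset.sum_ite_eq', if_pos hp', if_pos hq',
          sub_self]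

/-- The bead set of the runner through position `a` on the `s`-runner abacus. -/
def runner (s : ℕ) (μ : YoungDiagram) (a : ℤ) : Set ℤ := {j | a + s * j ∈ μ.beads}

theorem mem_runner {s : ℕ} {μ : YoungDiagram} {a j : ℤ} :
    j ∈ runner s μ a ↔ a + s * j ∈ μ.beads := Iff.rfl

theorem isMaya_runner {s : ℕ} (hs : 0 < s) (μ : YoungDiagram) (a : ℤ) :
    IsMaya (runner s μ a) := by
  obtain ⟨N, h1, h2⟩ := μ.exists_beads_bound
  have hs' : (1 : ℤ) ≤ s := by exact_mod_cast hs
  refine ⟨|N| + |a|, fun x hx => ?_, fun x hx => ?_⟩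
  · apply h1
    have := neg_abs_le N
    have := le_abs_self N
    have := le_abs_self a
    have := abs_nonneg N
    have := abs_nonneg a
    nlinarith
  · apply h2
    have := le_abs_self N
    have := neg_abs_le a
    have := abs_nonneg N
    have := abs_nonneg a
    nlinarith

theorem BeadMove.charge_runner {s : ℕ} (hs : 0 < s) {μ ν : YoungDiagram} {x y : ℤ}
    (h : BeadMove μ ν x y) (hxy : (s : ℤ) ∣ y - x) (a : ℤ) :
    charge (runner s ν a) = charge (runner s μ a) := by
  by_cases hax : (s : ℤ) ∣ x - a
  · obtain ⟨p, hp⟩ := hax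
    obtain ⟨q, hq⟩ : (s : ℤ) ∣ y - a := by
      have := dvd_add hxy ⟨p, hp⟩
      rwa [sub_add_sub_cancel] at this
    obtain rfl : x = a + s * p := by linarith
    obtain rfl : y = a + s * q := by linarith
    refine charge_move (isMaya_runner hs _ _) (isMaya_runner hs _ _) (p := p) (q := q)
      h.1 h.2.1 fun z => ?_
    rw [mem_runner, mem_runner, h.2.2]
    simp [hs.ne']
  · congr 1
    ext z
    rw [mem_runner, mem_runner, h.2.2]
    have h1 : a + s * z ≠ x := fun e => hax ⟨z, by linarith⟩
    have h2 : a + s * z ≠ y := fun e => hax (by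
      have h3 : (s : ℤ) ∣ y - a := ⟨z, by linarith⟩
      have := dvd_sub h3 hxy
      rwa [show y - a - (y - x) = x - a by ring] at this)
    tauto

/-! ### Cores -/

theorem isCore_iff {s : ℕ} (hs : 0 < s) {μ : YoungDiagram} :
    IsCore s μ ↔ ∀ x ∈ μ.beads, x - s ∈ μ.beads := by
  constructor
  · intro h x hx
    by_contra hy
    obtain ⟨ν, hν⟩ := exists_beadMove hx hy
    exact h ν (hν.removesRimHook hs)
  · intro h ν hν
    obtain ⟨-, x, hx⟩ := hν.exists_beadMove
    exact hx.2.1 (h x hx.1)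

theorem IsCore.sub_mul_mem {s : ℕ} (hs : 0 < s) {μ : YoungDiagram} (h : IsCore s μ) {x : ℤ}
    (hx : x ∈ μ.beads) (k : ℕ) : x - s * k ∈ μ.beads := by
  induction k with
  | zero => simpa using hx
  | succ k ih =>
    have := (isCore_iff hs).1 h _ ih
    rwa [show x - s * k - s = x - s * (k + 1 : ℕ) by push_cast; ring] at this

/-- Runners of a core are closed downwards, so two of them are nested, and equal charges then force
equality. -/
theorem IsCore.eq_of_charge_eq {s : ℕ} (hs : 0 < s) {μ ν : YoungDiagram} (hμ : IsCore s μ)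
    (hν : IsCore s ν) (h : ∀ a, charge (runner s μ a) = charge (runner s ν a)) : μ = ν := by
  have down : ∀ {ρ : YoungDiagram}, IsCore s ρ → ∀ {a i j : ℤ}, i ≤ j → j ∈ runner s ρ a →
      i ∈ runner s ρ a := by
    intro ρ hρ a i j hij hj
    have := hρ.sub_mul_mem hs hj (j - i).toNat
    rw [mem_runner]
    rwa [Int.toNat_of_nonneg (by omega), show a + s * j - s * (j - i) = a + s * i by ring] at this
  have key : ∀ a, runner s μ a = runner s ν a := by
    intro a
    by_cases hsub : runner s μ a ⊆ runner s ν a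
    · exact eq_of_subset_of_charge_eq (isMaya_runner hs _ _) (isMaya_runner hs _ _) hsub (h a)
    · obtain ⟨j, hj, hj'⟩ := Set.not_subset.1 hsub
      refine (eq_of_subset_of_charge_eq (isMaya_runner hs _ _) (isMaya_runner hs _ _)
        (fun i hi => ?_) (h a).symm).symm
      rcases le_total i j with hij | hij
      · exact down hμ hij hj
      · exact absurd (down hν hij hi) hj'
  refine beads_injective (Set.ext fun x => ?_)
  have := Set.ext_iff.1 (key x) 0
  simpa [mem_runner] using this

theorem RemovesRimHook.charge_runner {s : ℕ} {μ ν : YoungDiagram} (h : RemovesRimHook s μ ν)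
    (a : ℤ) : charge (runner s μ a) = charge (runner s ν a) := by
  obtain ⟨hs, x, hx⟩ := h.exists_beadMove
  exact (hx.charge_runner hs ⟨-1, by ring⟩ a).symm

theorem charge_runner_of_reflTransGen {s : ℕ} {μ ν : YoungDiagram}
    (h : Relation.ReflTransGen (RemovesRimHook s) μ ν) (a : ℤ) :
    charge (runner s μ a) = charge (runner s ν a) := by
  induction h with
  | refl => rfl
  | tail _ h ih => exact ih.trans (h.charge_runner a)

theorem exists_hasCore {s : ℕ} (hs : 0 < s) (μ : YoungDiagram) : ∃ σ, HasCore s μ σ := by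
  induction hn : μ.card using Nat.strong_induction_on generalizing μ with
  | _ n ih =>
    by_cases h : IsCore s μ
    · exact ⟨μ, .refl, h⟩
    · rw [IsCore] at h
      push Not at h
      obtain ⟨ν, hν⟩ := h
      obtain ⟨σ, h1, h2⟩ := ih ν.card (by have := hν.card_eq; omega) ν rfl
      exact ⟨σ, h1.head hν, h2⟩

theorem hasCore_iff {s : ℕ} (hs : 0 < s) {μ σ : YoungDiagram} :
    HasCore s μ σ ↔ IsCore s σ ∧ ∀ a, charge (runner s μ a) = charge (runner s σ a) := by
  constructor
  · exact fun h => ⟨h.2, charge_runner_of_reflTransGen h.1⟩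
  · rintro ⟨h1, h2⟩
    obtain ⟨ρ, h3, h4⟩ := exists_hasCore hs μ
    obtain rfl : ρ = σ :=
      h4.eq_of_charge_eq hs h1 fun a => (charge_runner_of_reflTransGen h3 a).symm.trans (h2 a)
    exact ⟨h3, h4⟩

theorem HasCore.of_beadMove {s : ℕ} (hs : 0 < s) {μ ν σ : YoungDiagram} (h : HasCore s μ σ)
    {x y : ℤ} (hm : BeadMove μ ν x y) (hxy : (s : ℤ) ∣ y - x) : HasCore s ν σ := by
  rw [hasCore_iff hs] at h ⊢
  exact ⟨h.1, fun a => (hm.charge_runner hs hxy a).trans (h.2 a)⟩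

theorem HasCore.eq_of_isCore {s : ℕ} {μ σ : YoungDiagram} (h : HasCore s μ σ)
    (hμ : IsCore s μ) : μ = σ := by
  rcases h.1.cases_head with h | ⟨ν, h, -⟩
  · exact h
  · exact absurd h (hμ ν)

theorem HasCore.exists_card_eq {s : ℕ} {μ σ : YoungDiagram} (h : HasCore s μ σ) :
    ∃ w : ℕ, μ.card = σ.card + s * w := by
  obtain ⟨h, -⟩ := h
  induction h using Relation.ReflTransGen.head_induction_on with
  | refl => exact ⟨0, by simp⟩
  | head h _ ih =>
    obtain ⟨w, hw⟩ := ih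
    refine ⟨w + 1, ?_⟩
    rw [h.card_eq, hw]
    ring

theorem HasCore.eq_of_card_eq {s : ℕ} (hs : 0 < s) {μ σ : YoungDiagram} (h : HasCore s μ σ)
    (hc : μ.card = σ.card) : μ = σ := by
  rcases h.1.cases_head with h1 | ⟨ν, h1, h2⟩
  · exact h1
  · obtain ⟨w, hw⟩ := HasCore.exists_card_eq ⟨h2, h.2⟩
    have := h1.card_eq
    omega

theorem HasCore.beadMove_of_card_eq {s : ℕ} (hs : 0 < s) {μ σ : YoungDiagram} (h : HasCore s μ σ)
    (hc : μ.card = σ.card + s) : ∃ x, BeadMove μ σ x (x - s) := by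
  rcases h.1.cases_head with h1 | ⟨ν, h1, h2⟩
  · subst h1
    omega
  · have hν : HasCore s ν σ := ⟨h2, h.2⟩
    have := h1.card_eq
    obtain rfl := hν.eq_of_card_eq hs (by omega)
    exact h1.exists_beadMove.2

/-! ### Partitions with given cores -/

theorem partitionsWithCores_comm (s t n : ℕ) (σ τ : YoungDiagram) :
    partitionsWithCores s t n σ τ = partitionsWithCores t s n τ σ := by
  ext μ
  simp only [partitionsWithCores, Set.mem_ofPred_eq]
  tauto

theorem IsMaya.exists_max {A : Set ℤ} (hA : IsMaya A) : ∃ j ∈ A, ∀ i, j < i → i ∉ A := by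
  obtain ⟨N, h1, h2⟩ := hA
  obtain ⟨j, hj, hmax⟩ := Int.exists_greatest_of_bdd (P := (· ∈ A))
    ⟨N, fun z hz => by by_contra! h; exact h2 z h hz⟩ ⟨-N - 1, h1 _ (by omega)⟩
  exact ⟨j, hj, fun i hi hiA => by have := hmax i hiA; omega⟩

section

variable {s t n : ℕ} {σ τ : YoungDiagram}

/-- Above a member of the family there are at least three partitions (one for each of the
residues `0`, `1`, `2` modulo `s * t`). -/
theorem ncard_ne_two_of_card_lt (hs : 1 < s) (ht : 1 < t) (hst : s.Coprime t) {m w : ℕ}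
    {μ : YoungDiagram} (hμ : μ ∈ partitionsWithCores s t m σ τ) (hw : 0 < w)
    (hn : n = m + s * t * w) : (partitionsWithCores s t n σ τ).ncard ≠ 2 := by
  obtain ⟨hm, hσ, hτ⟩ := hμ
  have hst0 : 0 < s * t := by positivity
  have hst3 : 3 ≤ s * t := by
    rcases Nat.lt_or_ge s 3 with h | h
    · have : s = 2 := by omega
      subst this
      omega
    · nlinarith
  have key : ∀ i : ℤ, ∃ ν ∈ partitionsWithCores s t n σ τ, ∃ y : ℤ,
      ((s * t : ℕ) : ℤ) ∣ y - i ∧ y ∈ ν.beads ∧ y ∉ μ.beads ∧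
        ∀ z ∈ ν.beads, z ∉ μ.beads → z = y := by
    intro i
    -- The last bead on the runner of `i` modulo `s * t` moves up `w` places. Its new position is
    -- the only bead of `ν` outside `μ`, so it reveals the residue of `i`.
    obtain ⟨j, hj, hmax⟩ := (isMaya_runner hst0 μ i).exists_max
    have hy := hmax (j + w) (by omega)
    obtain ⟨ν, hν⟩ := exists_beadMove (mem_runner.1 hj) (fun h => hy (mem_runner.2 h))
    have hd : i + ((s * t : ℕ) : ℤ) * (j + w) - (i + ((s * t : ℕ) : ℤ) * j) = s * t * w := by
      push_cast; ring
    refine ⟨ν, ⟨?_, ?_, ?_⟩, _, ⟨j + w, by ring⟩, hν.symm.1, hν.2.1, fun z hz hz' => ?_⟩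
    · have := hν.card_eq
      rw [hd, hm] at this
      rw [hn]
      exact_mod_cast this
    · exact hσ.of_beadMove (by omega) hν (hd ▸ ⟨t * w, by ring⟩)
    · exact hτ.of_beadMove (by omega) hν (hd ▸ ⟨s * w, by ring⟩)
    · rcases (hν.2.2 z).1 hz with h | h
      · exact h
      · exact absurd h.1 hz'
  choose ν hν y hdvd hy hy' huniq using key
  have hne : ∀ i j : ℤ, i < j → j < i + 3 → ν i ≠ ν j := by
    intro i j hij hji h
    have e : y i = y j := huniq j _ (h ▸ hy i) (hy' i)
    have h1 := dvd_sub (hdvd i) (hdvd j)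
    rw [e, show y j - i - (y j - j) = j - i by ring] at h1
    have := Int.le_of_dvd (by omega) h1
    omega
  intro h2
  obtain ⟨a, b, -, hab⟩ := Set.ncard_eq_two.1 h2
  have h01 := hne 0 1 (by norm_num) (by norm_num)
  have h02 := hne 0 2 (by norm_num) (by norm_num)
  have h12 := hne 1 2 (by norm_num) (by norm_num)
  have m0 := hν 0
  have m1 := hν 1
  have m2 := hν 2
  rw [hab] at m0 m1 m2
  rcases m0 with m0 | m0 <;> rcases m1 with m1 | m1 <;> rcases m2 with m2 | m2 <;>
    first
    | exact h01 (m0.trans m1.symm)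
    | exact h02 (m0.trans m2.symm)
    | exact h12 (m1.trans m2.symm)

/-- Removing a rim `s * t`-hook keeps both cores and would give a smaller member. -/
theorem isCore_mul_of_ncard_eq_two (hs : 1 < s) (ht : 1 < t) (hst : s.Coprime t)
    (h2 : (partitionsWithCores s t n σ τ).ncard = 2) {μ : YoungDiagram}
    (hμ : μ ∈ partitionsWithCores s t n σ τ) : IsCore (s * t) μ := by
  intro ν hν
  have hc := hν.card_eq
  obtain ⟨-, x, hx⟩ := hν.exists_beadMove
  refine ncard_ne_two_of_card_lt hs ht hst (μ := ν) (m := ν.card) (w := 1)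
    ⟨rfl, ?_, ?_⟩ one_pos (by rw [mul_one, ← hc]; exact hμ.1.symm) h2
  · exact hμ.2.1.of_beadMove (by omega) hx ⟨-t, by push_cast; ring⟩
  · exact hμ.2.2.of_beadMove (by omega) hx ⟨-s, by push_cast; ring⟩

/-! ### Switches, and the consequences of having exactly two partitions -/

/-- Beads `x`, `x'` and empty positions `y`, `y'` forming a parallelogram with one side a multiple
of `s` and the other a multiple of `t`. -/
structure IsSwitch (s t : ℕ) (μ : YoungDiagram) (x x' y y' : ℤ) : Prop where
  left : x ∈ μ.beads
  right : x' ∈ μ.beads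
  left_gap : y ∉ μ.beads
  right_gap : y' ∉ μ.beads
  dvd_s : (s : ℤ) ∣ y - x
  dvd_t : (t : ℤ) ∣ y' - x
  add_eq : x + x' = y + y'

/-- In a degenerate parallelogram all differences are multiples of `s * t`, which puts a gap below a
bead on a runner of an `s * t`-core. -/
theorem IsSwitch.ne {μ : YoungDiagram} {x x' y y' : ℤ} (h : IsSwitch s t μ x x' y y')
    (hst0 : 0 < s * t) (hst : s.Coprime t) (hμ : IsCore (s * t) μ) : x ≠ x' ∧ y ≠ y' := by
  have hcop : IsCoprime (s : ℤ) t := Nat.isCoprime_iff_coprime.2 hst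
  have up : ∀ z ∈ μ.beads, ∀ k : ℤ, 0 ≤ k → z - s * t * k ∈ μ.beads := by
    intro z hz k hk
    have := hμ.sub_mul_mem hst0 hz k.toNat
    rwa [Int.toNat_of_nonneg hk, Nat.cast_mul] at this
  obtain ⟨h1, h2, h3, h4, h5, h6, h7⟩ := h
  constructor
  · rintro rfl
    obtain ⟨k, hk⟩ := hcop.mul_dvd h5 (by
      rw [← dvd_neg, show -(y - x) = y' - x by linarith]; exact h6)
    rcases le_total 0 k with h | h
    · exact h4 ((show y' = x - s * t * k by linarith) ▸ up x h1 k h)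
    · exact h3 ((show y = x - s * t * (-k) by linarith) ▸ up x h1 (-k) (by omega))
  · rintro rfl
    obtain ⟨k, hk⟩ := hcop.mul_dvd h5 h6
    rcases le_total 0 k with h | h
    · exact h3 ((show y = x' - s * t * k by linarith) ▸ up x' h2 k h)
    · exact h3 ((show y = x - s * t * (-k) by linarith) ▸ up x h1 (-k) (by omega))

/-- The moves `x → y`, `x' → y'` are by multiples of `s`, while `x → y'`, `x' → y` are by multiples
of `t`. Both pairs end at the same bead set, so both cores survive. -/
theorem IsSwitch.exists_mem (hs : 0 < s) (ht : 0 < t) {μ : YoungDiagram} {x x' y y' : ℤ}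
    (h : IsSwitch s t μ x x' y y')
    (hx : x ≠ x') (hy : y ≠ y') (hμ : μ ∈ partitionsWithCores s t n σ τ) :
    ∃ ν ∈ partitionsWithCores s t n σ τ,
      ∀ z, z ∈ ν.beads ↔ z = y ∨ z = y' ∨ z ∈ μ.beads ∧ z ≠ x ∧ z ≠ x' := by
  obtain ⟨h1, h2, h3, h4, h5, h6, h7⟩ := h
  have two : ∀ {a b : ℤ}, a ∉ μ.beads → b ∉ μ.beads → a ≠ b → ∃ ρ ν, BeadMove μ ρ x a ∧
      BeadMove ρ ν x' b := by
    intro a b ha hb hab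
    obtain ⟨ρ, hρ⟩ := exists_beadMove h1 ha
    obtain ⟨ν, hν⟩ := exists_beadMove (μ := ρ) (x := x') (y := b)
      ((hρ.2.2 _).2 (Or.inr ⟨h2, hx.symm⟩)) (fun h => by
        rcases (hρ.2.2 _).1 h with h | h
        · exact hab h.symm
        · exact hb h.1)
    exact ⟨ρ, ν, hρ, hν⟩
  obtain ⟨ρ, ν, hρ, hν⟩ := two h3 h4 hy
  obtain ⟨ρ', ν', hρ', hν'⟩ := two h4 h3 hy.symm
  have hx3 : x' ≠ y := fun e => h3 (e ▸ h2)
  have hx4 : x' ≠ y' := fun e => h4 (e ▸ h2)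
  have hz : ∀ z, z ∈ ν.beads ↔ z = y ∨ z = y' ∨ z ∈ μ.beads ∧ z ≠ x ∧ z ≠ x' := by
    intro z
    rw [hν.2.2, hρ.2.2]
    by_cases e : z = y
    · subst e; tauto
    · tauto
  have hz' : ∀ z, z ∈ ν'.beads ↔ z = y ∨ z = y' ∨ z ∈ μ.beads ∧ z ≠ x ∧ z ≠ x' := by
    intro z
    rw [hν'.2.2, hρ'.2.2]
    by_cases e : z = y'
    · subst e; tauto
    · tauto
  obtain rfl : ν = ν' := beads_injective (Set.ext fun z => (hz z).trans (hz' z).symm)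
  refine ⟨ν, ⟨?_, ?_, ?_⟩, hz⟩
  · have e1 := hρ.card_eq
    have e2 := hν.card_eq
    have e3 := hμ.1
    omega
  · refine (hμ.2.1.of_beadMove hs hρ h5).of_beadMove hs hν ?_
    rw [show y' - x' = -(y - x) by linarith, dvd_neg]
    exact h5
  · refine (hμ.2.2.of_beadMove ht hρ' h6).of_beadMove ht hν' ?_
    rw [show y - x' = -(y' - x) by linarith, dvd_neg]
    exact h6

/-- Every switch leads to the one member other than `μ`, whose beads reveal both diagonals of the
parallelogram. -/
theorem IsSwitch.unique (hs : 1 < s) (ht : 1 < t) (hst : s.Coprime t)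
    (h2 : (partitionsWithCores s t n σ τ).ncard = 2) {μ : YoungDiagram}
    (hμ : μ ∈ partitionsWithCores s t n σ τ) {x x' y y' a a' b b' : ℤ}
    (h : IsSwitch s t μ x x' y y') (h' : IsSwitch s t μ a a' b b') :
    (a = x ∧ a' = x' ∨ a = x' ∧ a' = x) ∧ (b = y ∧ b' = y' ∨ b = y' ∧ b' = y) := by
  have hcore := isCore_mul_of_ncard_eq_two hs ht hst h2 hμ
  have hst0 : 0 < s * t := by positivity
  have hne := h.ne hst0 hst hcore
  have hne' := h'.ne hst0 hst hcore
  obtain ⟨ν, hν, hz⟩ := h.exists_mem (by omega) (by omega) hne.1 hne.2 hμ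
  obtain ⟨ρ, hρ, hw⟩ := h'.exists_mem (by omega) (by omega) hne'.1 hne'.2 hμ
  have hνμ : ν ≠ μ := fun e => h.left_gap (e ▸ (hz y).2 (Or.inl rfl))
  have hρμ : ρ ≠ μ := fun e => h'.left_gap (e ▸ (hw b).2 (Or.inl rfl))
  obtain rfl : ν = ρ := by
    obtain ⟨c, d, -, hcd⟩ := Set.ncard_eq_two.1 h2
    rw [hcd] at hμ hν hρ
    rcases hμ with rfl | rfl <;> rcases hν with rfl | rfl <;> rcases hρ with rfl | rfl <;>
      first | rfl | exact absurd rfl hνμ | exact absurd rfl hρμ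
  have new : ∀ z, z ∉ μ.beads → (z = y ∨ z = y' ↔ z = b ∨ z = b') := by
    intro z hzμ
    have := (hz z).symm.trans (hw z)
    tauto
  have old : ∀ z, z ∈ μ.beads → (z = x ∨ z = x' ↔ z = a ∨ z = a') := by
    intro z hzμ
    have := (hz z).symm.trans (hw z)
    have e1 : z ≠ y := fun e => h.left_gap (e ▸ hzμ)
    have e2 : z ≠ y' := fun e => h.right_gap (e ▸ hzμ)
    have e3 : z ≠ b := fun e => h'.left_gap (e ▸ hzμ)
    have e4 : z ≠ b' := fun e => h'.right_gap (e ▸ hzμ)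
    tauto
  have n1 := new b h'.left_gap
  have n2 := new b' h'.right_gap
  have o1 := old a h'.left
  have o2 := old a' h'.right
  omega

/-- The charges are those of `σ`; as `σ` is a `t`-core, its runner through `a + t * k` is contained
in the one through `a`. -/
theorem charge_runner_anti (hs : 0 < s) (ht : 0 < t) {μ : YoungDiagram} (h : HasCore s μ σ)
    (hσ : IsCore t σ) (a : ℤ) {k : ℤ} (hk : 0 ≤ k) :
    charge (runner s μ (a + t * k)) ≤ charge (runner s μ a) := by
  rw [charge_runner_of_reflTransGen h.1, charge_runner_of_reflTransGen h.1]
  refine charge_mono (isMaya_runner hs _ _) (isMaya_runner hs _ _) fun j hj => ?_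
  have := hσ.sub_mul_mem ht hj k.toNat
  rw [Int.toNat_of_nonneg hk] at this
  rw [mem_runner]
  rwa [show a + t * k + s * j - t * k = a + s * j by ring] at this

/-- The `t`-runner through `z - s` has at least the charge of the one through `z`. Without a switch
it would be contained in it, hence equal to it, against `z` being a bead and `z - s` a gap. -/
theorem exists_switch_of_notMem (hs : 0 < s) (ht : 0 < t) {μ : YoungDiagram} (h : HasCore t μ τ)
    (hτ : IsCore s τ) {z : ℤ} (hz : z ∈ μ.beads) (hz' : z - s ∉ μ.beads) :
    ∃ m : ℤ, IsSwitch s t μ z (z - s + t * m) (z - s) (z + t * m) := by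
  by_contra! hcon
  have hsub : runner t μ (z - s) ⊆ runner t μ z := by
    intro m hm
    by_contra hm'
    exact hcon m ⟨hz, hm, hz', hm', ⟨-1, by ring⟩, ⟨m, by ring⟩, by ring⟩
  have h1 := charge_runner_anti ht hs h hτ (z - s) zero_le_one
  rw [mul_one, sub_add_cancel] at h1
  have h2 := charge_mono (isMaya_runner ht _ _) (isMaya_runner ht _ _) hsub
  have h3 := eq_of_subset_of_charge_eq (isMaya_runner ht _ _) (isMaya_runner ht _ _) hsub
    (le_antisymm h2 h1)
  have h4 : (0 : ℤ) ∈ runner t μ z := by simpa [mem_runner] using hz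
  rw [← h3, mem_runner] at h4
  exact hz' (by simpa using h4)

theorem card_eq_of_ncard_eq_two_of_not_isCore (hs : 1 < s) (ht : 1 < t) (hst : s.Coprime t)
    (hσt : IsCore t σ) (hτs : IsCore s τ)
    (h2 : (partitionsWithCores s t n σ τ).ncard = 2) {μ : YoungDiagram}
    (hμ : μ ∈ partitionsWithCores s t n σ τ) (hcore : ¬ IsCore s μ) :
    n = σ.card + s ∧ ¬ IsCore t μ := by
  have hs0 : 0 < s := by omega
  have ht0 : 0 < t := by omega
  have hsz : (0 : ℤ) < s := by exact_mod_cast hs0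
  have htz : (0 : ℤ) < t := by exact_mod_cast ht0
  have hdvd : ¬ (s : ℤ) ∣ t := fun h => by
    have := Nat.Coprime.eq_one_of_dvd hst (by exact_mod_cast h)
    omega
  have hdvd' : ¬ (t : ℤ) ∣ s := fun h => by
    have := Nat.Coprime.eq_one_of_dvd hst.symm (by exact_mod_cast h)
    omega
  rw [isCore_iff hs0] at hcore
  push Not at hcore
  obtain ⟨x, hx, hx'⟩ := hcore
  obtain ⟨m, hm⟩ := exists_switch_of_notMem hs0 ht0 hμ.2.2 hτs hx hx'
  have uniq := fun {a a' b b' : ℤ} (h' : IsSwitch s t μ a a' b b') =>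
    IsSwitch.unique hs ht hst h2 hμ hm h'
  have hm0 : m ≠ 0 := by
    rintro rfl
    exact hx' (by simpa using hm.right)
  have hR : ∀ j : ℤ, x + s * j ∈ μ.beads → x + t * m + s * j ∉ μ.beads → j = 0 := by
    intro j h1 h1'
    have := (uniq (a := x + s * j) (a' := x - s + t * m) (b := x - s) (b' := x + t * m + s * j)
      ⟨h1, hm.right, hx', h1', ⟨-1 - j, by ring⟩, ⟨m, by ring⟩, by ring⟩).1
    have : (s : ℤ) * j = 0 := by omega
    rcases mul_eq_zero.1 this with h | h
    · omega
    · exact h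
  have hR' : ∀ j : ℤ, x + t * m + s * j ∈ μ.beads → x + s * j ∉ μ.beads → j = -1 := by
    intro j h1 h1'
    have := (uniq (a := x) (a' := x + t * m + s * j) (b := x + s * j) (b' := x + t * m)
      ⟨hx, h1, h1', hm.right_gap, ⟨j, by ring⟩, ⟨m, by ring⟩, by ring⟩).1
    have : (s : ℤ) * (j + 1) = 0 := by rw [mul_add, mul_one]; omega
    rcases mul_eq_zero.1 this with h | h
    · omega
    · omega
  -- By `hR` and `hR'`, the `s`-runners through `x` and `x + t * m` differ only by a bead moved from
  -- `0` to `-1`.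
  have hcharge : charge (runner s μ (x + t * m)) = charge (runner s μ x) := by
    refine charge_move (p := 0) (q := -1) (isMaya_runner hs0 _ _) (isMaya_runner hs0 _ _)
      (by simpa [mem_runner] using hx) (by simpa [mem_runner, ← sub_eq_add_neg] using hx')
      fun z => ?_
    rw [mem_runner, mem_runner]
    have r1 := hR z
    have r2 := hR' z
    have e1 : z = -1 → x + t * m + s * z ∈ μ.beads := by
      rintro rfl
      rw [show x + t * m + s * -1 = x - s + t * m by ring]
      exact hm.right
    have e2 : z = 0 → x + t * m + s * z ∉ μ.beads := by
      rintro rfl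
      rw [mul_zero, add_zero]
      exact hm.right_gap
    tauto
  -- Runners of equal charge either coincide, and then the descent at `x` recurs at `x + t * e` and
  -- gives a second switch, or are not nested, and then a switch between them has `t`-side `t * e`.
  have hmid : ∀ e : ℤ, e = 1 ∨ e = -1 →
      charge (runner s μ (x + t * e)) = charge (runner s μ x) → e = m := by
    intro e he hce
    have hse : ∀ j : ℤ, (s : ℤ) * j ≠ t * e := by
      intro j hj
      rcases he with rfl | rfl
      · exact hdvd ⟨j, by linarith⟩
      · exact hdvd ⟨-j, by linarith⟩
    by_cases hsub : runner s μ x ⊆ runner s μ (x + t * e)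
    · have heq := eq_of_subset_of_charge_eq (isMaya_runner hs0 _ _) (isMaya_runner hs0 _ _) hsub
        hce.symm
      have b1 : x + t * e ∈ μ.beads := by
        have : (0 : ℤ) ∈ runner s μ x := by simpa [mem_runner] using hx
        rw [heq, mem_runner] at this
        simpa using this
      have b2 : x + t * e - s ∉ μ.beads := by
        have : (-1 : ℤ) ∉ runner s μ x := by
          simpa [mem_runner, ← sub_eq_add_neg] using hx'
        rw [heq, mem_runner] at this
        simpa [← sub_eq_add_neg] using this
      have := (uniq (a := x + t * e) (a' := x - s + t * m) (b := x + t * e - s) (b' := x + t * m)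
        ⟨b1, hm.right, b2, hm.right_gap, ⟨-1, by ring⟩, ⟨m - e, by ring⟩, by ring⟩).1
      have : (t : ℤ) * e = 0 := by omega
      rcases mul_eq_zero.1 this with h | h <;> omega
    · obtain ⟨i, hi, hi'⟩ := Set.not_subset.1 hsub
      obtain ⟨j, hj, hj'⟩ : ∃ j ∈ runner s μ (x + t * e), j ∉ runner s μ x := by
        by_contra! hcon
        exact hsub (eq_of_subset_of_charge_eq (isMaya_runner hs0 _ _) (isMaya_runner hs0 _ _)
          hcon hce).symm.subset
      rw [mem_runner] at hi hi' hj hj'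
      obtain ⟨u1, u2⟩ := uniq (a := x + s * i) (a' := x + t * e + s * j) (b := x + s * j)
        (b' := x + t * e + s * i)
        ⟨hi, hj, hj', hi', ⟨j - i, by ring⟩, ⟨e, by ring⟩, by ring⟩
      have k1 := hse (-j)
      have k2 := hse (-1)
      rw [mul_neg] at k1
      rw [mul_neg, mul_one] at k2
      have : (t : ℤ) * e = t * m := by omega
      exact mul_left_cancel₀ htz.ne' this
  -- Charges are monotone along `t`-steps and agree at `x` and `x + t * m`, so also at the neighbour
  -- of `x` in between.
  have hm1 : m = 1 ∨ m = -1 := by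
    rcases lt_or_gt_of_ne hm0 with h | h
    · right
      refine (hmid (-1) (Or.inr rfl) (le_antisymm ?_ ?_)).symm
      · rw [← hcharge]
        have := charge_runner_anti hs0 ht0 hμ.2.1 hσt (x + t * m) (k := -1 - m) (by omega)
        rwa [show x + t * m + t * (-1 - m) = x + t * -1 by ring] at this
      · have := charge_runner_anti hs0 ht0 hμ.2.1 hσt (x + t * -1) (k := 1) (by omega)
        rwa [show x + t * -1 + t * 1 = x by ring] at this
    · left
      refine (hmid 1 (Or.inl rfl) (le_antisymm ?_ ?_)).symm
      · exact charge_runner_anti hs0 ht0 hμ.2.1 hσt x (k := 1) (by omega)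
      · rw [← hcharge]
        have := charge_runner_anti hs0 ht0 hμ.2.1 hσt (x + t * 1) (k := m - 1) (by omega)
        rwa [show x + t * 1 + t * (m - 1) = x + t * m by ring] at this
  have hasc : ∀ z ∈ μ.beads, z - s ∉ μ.beads → z = x := by
    intro z hz hz'
    obtain ⟨m', hm'⟩ := exists_switch_of_notMem hs0 ht0 hμ.2.2 hτs hz hz'
    have := uniq hm'
    omega
  constructor
  · obtain ⟨ν, hν⟩ := exists_beadMove hx hx'
    -- A new descent could only come from a gap at `x - 2s` or a bead at `x + s`. Either is copied
    -- onto the runner through `x + t * m`, where it gives a descent other than `x`, since `t` does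
    -- not divide `s`.
    have hνc : IsCore s ν := by
      rw [isCore_iff hs0]
      intro z hz
      by_contra hzs
      rw [hν.2.2] at hz hzs
      push Not at hzs
      obtain ⟨hzs1, hzs2⟩ := hzs
      rcases hz with rfl | ⟨hz, hzx⟩
      · have h1 : x + s * (-2) ∉ μ.beads := by
          rw [show x + s * (-2) = x - s - s by ring]
          intro h
          have := hzs2 h
          omega
        have h3 : x + t * m + s * (-2) ∉ μ.beads := fun h => by
          have := hR' _ h h1
          omega
        have := hasc (x - s + t * m) hm.right (by
          rwa [show x - s + t * m - s = x + t * m + s * (-2) by ring])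
        rcases hm1 with rfl | rfl
        · exact hdvd' ⟨1, by linarith⟩
        · exact hdvd' ⟨-1, by linarith⟩
      · by_cases h : z - s ∈ μ.beads
        · have hzx' := hzs2 h
          have h1 : x + s * 1 ∈ μ.beads := by
            rwa [show x + s * 1 = z by rw [← hzx']; ring]
          have h3 : x + t * m + s * 1 ∈ μ.beads := by
            by_contra h3
            have := hR _ h1 h3
            omega
          have := hasc _ h3 (by
            rw [show x + t * m + s * 1 - s = x + t * m by ring]
            exact hm.right_gap)
          rcases hm1 with rfl | rfl
          · exact hdvd' ⟨-1, by linarith⟩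
          · exact hdvd' ⟨1, by linarith⟩
        · exact hzx (hasc z hz h)
    have hνσ : ν = σ := (hμ.2.1.of_beadMove hs0 hν ⟨-1, by ring⟩).eq_of_isCore hνc
    have := hν.card_eq
    rw [hνσ, hμ.1] at this
    omega
  · rw [isCore_iff ht0]
    push Not
    rcases hm1 with rfl | rfl
    · refine ⟨_, hm.right, ?_⟩
      rw [show x - s + t * 1 - t = x - s by ring]
      exact hx'
    · refine ⟨x, hx, ?_⟩
      have := hm.right_gap
      rwa [show x + t * -1 = x - t by ring] at this

theorem card_eq_of_ncard_eq_two (hs : 1 < s) (ht : 1 < t) (hst : s.Coprime t)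
    (hσt : IsCore t σ) (hτs : IsCore s τ)
    (h2 : (partitionsWithCores s t n σ τ).ncard = 2) :
    n = σ.card + s ∧ n = τ.card + t := by
  obtain ⟨μ, hμ⟩ : (partitionsWithCores s t n σ τ).Nonempty :=
    Set.nonempty_of_ncard_ne_zero (by omega)
  have left : ¬ IsCore s μ → n = σ.card + s ∧ ¬ IsCore t μ :=
    card_eq_of_ncard_eq_two_of_not_isCore hs ht hst hσt hτs h2 hμ
  have right : ¬ IsCore t μ → n = τ.card + t ∧ ¬ IsCore s μ := by
    rw [partitionsWithCores_comm] at h2 hμ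
    exact card_eq_of_ncard_eq_two_of_not_isCore ht hs hst.symm hτs hσt h2 hμ
  by_cases h : IsCore s μ
  · have hσ := hμ.2.1.eq_of_isCore h
    -- If `μ` is an `s`-core then `n = σ.card`, and `σ` is the only partition of that size with
    -- `s`-core `σ`.
    have : partitionsWithCores s t n σ τ = {μ} := by
      refine Set.eq_singleton_iff_unique_mem.2 ⟨hμ, fun ρ hρ => ?_⟩
      rw [hσ]
      exact hρ.2.1.eq_of_card_eq (by omega) (by rw [← hσ, hρ.1, hμ.1])
    rw [this, Set.ncard_singleton] at h2
    omega
  · exact ⟨(left h).1, (right (left h).2).1⟩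

theorem le_card_of_ncard_eq_two (hs : 1 < s) (ht : 1 < t) (hst : s.Coprime t)
    (h2 : (partitionsWithCores s t n σ τ).ncard = 2) {m : ℕ}
    (hm : (partitionsWithCores s t m σ τ).Nonempty) : n ≤ m := by
  by_contra! hlt
  obtain ⟨μ, hμ⟩ := hm
  obtain ⟨ν, hν⟩ : (partitionsWithCores s t n σ τ).Nonempty :=
    Set.nonempty_of_ncard_ne_zero (by omega)
  obtain ⟨a, ha⟩ := hμ.2.1.exists_card_eq
  obtain ⟨b, hb⟩ := hμ.2.2.exists_card_eq
  obtain ⟨c, hc⟩ := hν.2.1.exists_card_eq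
  obtain ⟨d, hd⟩ := hν.2.2.exists_card_eq
  rw [hμ.1] at ha hb
  rw [hν.1] at hc hd
  have e1 : s ∣ n - m := by
    rw [hc, ha, Nat.add_sub_add_left, ← Nat.mul_sub]
    exact Dvd.intro _ rfl
  have e2 : t ∣ n - m := by
    rw [hd, hb, Nat.add_sub_add_left, ← Nat.mul_sub]
    exact Dvd.intro _ rfl
  obtain ⟨w, hw⟩ := hst.mul_dvd_of_dvd_of_dvd e1 e2
  refine ncard_ne_two_of_card_lt hs ht hst hμ (w := w) ?_ (by omega) h2
  rcases Nat.eq_zero_or_pos w with rfl | h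
  · omega
  · exact h

/-! ### Partitions one hook above both cores -/

/-- If `σ` and `τ` are reached from `μ` by removing one rim `s`-hook and one rim `t`-hook
respectively, then `τ` arises from `σ` by moving one bead `x` by `s - t`, and `μ` is one of two
partitions. -/
theorem exists_beadMove_of_card_eq (hs : 0 < s) (ht : 0 < t) (hst : s ≠ t) (hσt : IsCore t σ)
    (hσ : n = σ.card + s) (hτ : n = τ.card + t) {μ : YoungDiagram}
    (hμ : μ ∈ partitionsWithCores s t n σ τ) :
    ∃ x : ℤ, BeadMove σ τ x (x + s - t) ∧
      (BeadMove σ μ x (x + s) ∨ BeadMove σ μ (x - t) (x + s - t)) := by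
  obtain ⟨u, hu⟩ := hμ.2.1.beadMove_of_card_eq hs (by rw [hμ.1, hσ])
  obtain ⟨v, hv⟩ := hμ.2.2.beadMove_of_card_eq ht (by rw [hμ.1, hτ])
  by_cases huv : u = v
  · subst huv
    refine ⟨u - s, ⟨hu.symm.1, ?_, fun z => ?_⟩, Or.inl ?_⟩
    · rw [show u - s + s - t = u - t by ring, hu.2.2]
      rintro (h | h)
      · omega
      · exact hv.2.1 h.1
    · rw [hv.2.2, hu.2.2, show u - s + s - t = u - t by ring]
      have h1 := hu.2.1
      by_cases e : z = u - s
      · subst e; simp [h1]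
      · simp [e]
    · rw [sub_add_cancel]
      exact hu.symm
  -- Position `v - t` is a gap of `μ` but a bead of the `t`-core `σ`, so it is the bead `u - s`
  -- gained in passing to `σ`.
  · have h1 : v - t ∈ σ.beads :=
      (isCore_iff ht).1 hσt v ((hu.2.2 v).2 (Or.inr ⟨hv.1, Ne.symm huv⟩))
    have h2 : v - t = u - s := by
      rcases (hu.2.2 _).1 h1 with h | h
      · exact h
      · exact absurd h.1 hv.2.1
    have h3 : v + s - t = u := by linarith
    refine ⟨v, ⟨(hu.2.2 v).2 (Or.inr ⟨hv.1, Ne.symm huv⟩), ?_, fun z => ?_⟩, Or.inr ?_⟩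
    · rw [h3]
      exact hu.symm.2.1
    · rw [hv.2.2, hu.2.2, h3, h2]
      have h4 := hu.1
      have h5 := hu.2.1
      have h6 : u - s ≠ v := by omega
      by_cases e : z = u - s
      · subst e; simp [h6]
      · by_cases e' : z = u
        · subst e'; simp [h4, huv]
        · simp [e, e']
    · rw [h3, h2]
      exact hu.symm

theorem exists_removesRimHook_of_beadMove (hst : s ≠ t) {x : ℤ}
    (h : BeadMove σ τ x (x + s - t)) :
    (∃ k : ℕ, RemovesRimHook k τ σ) ∨ ∃ k : ℕ, RemovesRimHook k σ τ := by
  rcases lt_or_gt_of_ne hst with hlt | hlt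
  · right
    rw [show x + s - t = x - ((t - s : ℕ) : ℤ) by omega] at h
    exact ⟨t - s, h.removesRimHook (by omega)⟩
  · left
    have h' := h.symm
    rw [show BeadMove τ σ (x + s - t) x = BeadMove τ σ (x + s - t) (x + s - t - (s - t : ℕ)) by
      congr 1; omega] at h'
    exact ⟨s - t, h'.removesRimHook (by omega)⟩

theorem exists_beadMove_of_removesRimHook
    (h : (∃ k : ℕ, RemovesRimHook k τ σ) ∨ ∃ k : ℕ, RemovesRimHook k σ τ)
    (hc : σ.card + s = τ.card + t) : ∃ x : ℤ, BeadMove σ τ x (x + s - t) := by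
  rcases h with ⟨k, h⟩ | ⟨k, h⟩
  · have hk := h.card_eq
    obtain ⟨-, x, hx⟩ := h.exists_beadMove
    refine ⟨x - k, ?_⟩
    rw [show x - k + s - t = x by omega]
    exact hx.symm
  · have hk := h.card_eq
    obtain ⟨-, x, hx⟩ := h.exists_beadMove
    refine ⟨x, ?_⟩
    rwa [show x + s - t = x - k by omega]

theorem ncard_eq_two_of_beadMove (hs : 0 < s) (ht : 0 < t) (hst : s ≠ t)
    (hσs : IsCore s σ) (hσt : IsCore t σ) (hτt : IsCore t τ)
    (hσ : n = σ.card + s) (hτ : n = τ.card + t) {x : ℤ} (hx : BeadMove σ τ x (x + s - t)) :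
    (partitionsWithCores s t n σ τ).ncard = 2 := by
  have hxs : x + s ∉ σ.beads := fun h => hx.2.1 ((isCore_iff ht).1 hσt _ h)
  have hxt : x - t ∈ σ.beads := (isCore_iff ht).1 hσt _ hx.1
  obtain ⟨μ, hμ⟩ := exists_beadMove hx.1 hxs
  obtain ⟨ν, hν⟩ := exists_beadMove hxt hx.2.1
  have hμτ : BeadMove μ τ (x + s) (x + s - t) := by
    refine ⟨hμ.symm.1, fun h => ?_, fun z => ?_⟩
    · rcases (hμ.2.2 _).1 h with h | h
      · omega
      · exact hx.2.1 h.1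
    · rw [hx.2.2, hμ.2.2]
      by_cases e : z = x + s
      · subst e; simp [hxs]
      · simp [e]
  have hντ : BeadMove ν τ x (x - t) := by
    refine ⟨(hν.2.2 _).2 (Or.inr ⟨hx.1, by omega⟩), hν.symm.2.1, fun z => ?_⟩
    rw [hx.2.2, hν.2.2]
    have h1 : x + s - t ≠ x := by omega
    by_cases e : z = x - t
    · subst e
      simp [hxt, ht.ne']
    · by_cases e' : z = x + s - t
      · subst e'; simp [h1]
      · simp [e, e']
  have memμ : μ ∈ partitionsWithCores s t n σ τ := by
    refine ⟨?_, ⟨.single (BeadMove.removesRimHook (x := x + s) hs ?_), hσs⟩,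
      ⟨.single (hμτ.removesRimHook ht), hτt⟩⟩
    · have := hμ.card_eq
      omega
    · rw [add_sub_cancel_right]
      exact hμ.symm
  have memν : ν ∈ partitionsWithCores s t n σ τ := by
    refine ⟨?_, ⟨.single (BeadMove.removesRimHook (x := x + s - t) hs ?_), hσs⟩,
      ⟨.single (hντ.removesRimHook ht), hτt⟩⟩
    · have := hν.card_eq
      omega
    · rw [show x + s - t - s = x - t by ring]
      exact hν.symm
  have hne : μ ≠ ν := by
    rintro rfl
    have := (hμ.2.2 x).1 hντ.1
    rcases this with h | h
    · omega
    · exact h.2 rfl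
  refine Set.ncard_eq_two.2 ⟨μ, ν, hne, Set.ext fun ρ => ⟨fun hρ => ?_, ?_⟩⟩
  · obtain ⟨a, ha, hρ⟩ := exists_beadMove_of_card_eq hs ht hst hσt hσ hτ hρ
    -- The pair `σ`, `τ` determines the moved bead: `x` is the only bead of `σ` that `τ` lacks.
    obtain rfl : a = x := by
      by_contra hne
      have h1 := hx.symm.2.1
      have h2 := (ha.2.2 x).not.1 h1
      have := hx.1
      have e : x = a + s - t ∨ x = a := by tauto
      have h3 := ha.symm.2.1
      have h4 := (hx.2.2 a).not.1 h3
      have := ha.1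
      have e' : a = x + s - t ∨ a = x := by tauto
      omega
    rcases hρ with h | h
    · exact Or.inl (h.unique hμ)
    · exact Or.inr (h.unique hν)
  · rintro (rfl | rfl)
    · exact memμ
    · exact memν

end

end YoungDiagram

open YoungDiagram in
theorem proposition3p14 (s t : ℕ) (hs : 1 < s) (ht : 1 < t) (hst : Nat.Coprime s t)
    (σ τ : YoungDiagram)
    (hσs : IsCore s σ) (hσt : IsCore t σ) (hτs : IsCore s τ) (hτt : IsCore t τ) (n : ℕ) :
    List.TFAE [
      (partitionsWithCores s t n σ τ).ncard = 2,
      ((∃ k : ℕ, RemovesRimHook k τ σ) ∨ (∃ k : ℕ, RemovesRimHook k σ τ)) ∧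
        n = σ.card + s ∧ n = τ.card + t,
      n = minSize s t σ τ ∧ n = σ.card + s ∧ n = τ.card + t] := by
  have hne : s ≠ t := by
    rintro rfl
    rw [Nat.coprime_self] at hst
    omega
  tfae_have 1 → 3 := by
    intro h
    have hn : (partitionsWithCores s t n σ τ).Nonempty :=
      Set.nonempty_of_ncard_ne_zero (by omega)
    refine ⟨le_antisymm ?_ (Nat.sInf_le hn), card_eq_of_ncard_eq_two hs ht hst hσt hτs h⟩
    exact le_card_of_ncard_eq_two hs ht hst h
      (Nat.sInf_mem (s := {m | (partitionsWithCores s t m σ τ).Nonempty}) ⟨n, hn⟩)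
  tfae_have 3 → 2 := by
    rintro ⟨h1, h2, h3⟩
    refine ⟨?_, h2, h3⟩
    -- The infimum of the empty set is `0`, whereas `n = σ.card + s` is positive, so the minimum is
    -- attained.
    have hmem := Nat.sInf_mem (Nat.nonempty_of_pos_sInf
      (s := {m | (partitionsWithCores s t m σ τ).Nonempty})
      (by change 0 < minSize s t σ τ; omega))
    change (partitionsWithCores s t (minSize s t σ τ) σ τ).Nonempty at hmem
    rw [← h1] at hmem
    obtain ⟨μ, hμ⟩ := hmem
    obtain ⟨x, hx, -⟩ :=
      exists_beadMove_of_card_eq (by omega) (by omega) hne hσt h2 h3 hμ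
    exact exists_removesRimHook_of_beadMove hne hx
  tfae_have 2 → 1 := by
    rintro ⟨h1, h2, h3⟩
    obtain ⟨x, hx⟩ := exists_beadMove_of_removesRimHook h1 (h2.symm.trans h3)
    exact ncard_eq_two_of_beadMove (by omega) (by omega) hne hσs hσt hτt h2 h3 hx
  tfae_finish
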